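/- Let $(X,d,\alpha)$ be a computable metric space: $(X,d)$ is a metric space, $\alpha:\mathbb N\to X$ is a sequence with dense range, and $(i,j)\mapsto d(\alpha_i,\alpha_j)$ is a computable function $\mathbb N^2\to\mathbb R$ (i.e. there is a computable $G:\mathbb N^3\to\mathbb Q$ with $|d(\alpha_i,\alpha_j)-G(i,j,k)|<2^{-k}$ for all $i,j,k$). Let $(I_i)_{i\in\mathbb N}$ and $(\widehat I_i)_{i\in\mathbb N}$ be the effective enumerations of the open and the closed rational balls, $I_i=\{x: d(\lambda_i,x)<\rho_i\}$ and $\widehat I_i=\{x: d(\lambda_i,x)\le\rho_i\}$, where $((\lambda_i,\rho_i))_i$ is a fixed effective enumeration of all pairs of a point $\alpha_n$ and a positive rational number, and let $(J_j)_{j\in\mathbb N}$ be a fixed effective enumeration of all finite nonempty unions of open rational balls $I_i$. A set $S\subseteq X$ is called *computably enumerable* (c.e.) if it is closed and $\{i\in\mathbb N : S\cap I_i\ne\emptyset\}$ is a c.e. subset of $\mathbb N$; it is called *semi-c.c.b.* if $S\cap\{y : d(x,y)\le r\}$ is compact for all $x\in X$ and $r>0$, and $\{(i,j)\in\mathbb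 N^2 : \widehat I_i\cap S\subseteq J_j\}$ is a c.e. set; it is called *c.c.b.* if it is semi-c.c.b. and c.e. A *topological line* is a metric space homeomorphic to $\mathbb R$. (1) Let $L\subseteq X$ be a closed set which, as a subspace of $X$, is a topological line, and let $F\subseteq X$ be a closed set disjoint from $L$ such that $L\cup F$ is semi-c.c.b. Then $L$ is computably enumerable. (2) Consequently, every semi-c.c.b. set $L\subseteq X$ which, as a subspace of $X$, is a topological line is c.c.b. -/

import Mathlib

namespace CompMetric

/-- A function into `ℚ` is computable if it is `x ↦ (-1) ^ c x * a x / (b x + 1)` with computable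
`a`, `b`, `c`. -/
def IsComputableRat {β : Type*} [Primcodable β] (F : β → ℚ) : Prop :=
  ∃ a b c : β → ℕ, Computable a ∧ Computable b ∧ Computable c ∧
    ∀ x, F x = (-1) ^ c x * ((a x : ℚ) / ((b x : ℚ) + 1))

/-- A function `f` into `ℝ` is computable if a computable `F` into `ℚ` satisfies
`|f x - F (x, i)| < 2 ^ (-i)` for all `x` and `i`. -/
def IsComputableReal {β : Type*} [Primcodable β] (f : β → ℝ) : Prop :=
  ∃ F : β × ℕ → ℚ, IsComputableRat F ∧ ∀ (x : β) (i : ℕ), |f x - (F (x, i) : ℝ)| < (1 / 2) ^ i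

/-- `(X, d, α)` is a computable metric space: the sequence `α` is dense and
`(i, j) ↦ d (α i) (α j)` is a computable function. -/
structure IsComputableMetricSpace {X : Type*} [MetricSpace X] (α : ℕ → X) : Prop where
  dense : DenseRange α
  computable_dist : IsComputableReal fun p : ℕ × ℕ => dist (α p.1) (α p.2)

/-- A computable enumeration of the positive rational numbers. -/
def posRat (n : ℕ) : ℚ := ((n.unpair.1 : ℚ) + 1) / ((n.unpair.2 : ℚ) + 1)

theorem isComputableRat_posRat : IsComputableRat posRat := by
  refine ⟨fun n => n.unpair.1 + 1, fun n => n.unpair.2, fun _ => 0, ?_, ?_, Computable.const 0, ?_⟩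
  · exact (Primrec.succ.comp (Primrec.fst.comp Primrec.unpair)).to_comp
  · exact (Primrec.snd.comp Primrec.unpair).to_comp
  · intro n
    simp [posRat]

theorem range_posRat : Set.range posRat = {q : ℚ | 0 < q} := by
  ext q
  simp only [Set.mem_range, Set.mem_ofPred_eq]
  constructor
  · rintro ⟨n, rfl⟩
    unfold posRat
    positivity
  · intro hq
    refine ⟨Nat.pair (q.num.toNat - 1) (q.den - 1), ?_⟩
    have h1 : 0 < q.num := Rat.num_pos.mpr hq
    have h2 : ((q.num.toNat - 1 : ℕ) : ℚ) + 1 = q.num := by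
      have h : (((q.num.toNat - 1 : ℕ) : ℤ)) + 1 = q.num := by omega
      exact_mod_cast h
    have h3 : ((q.den - 1 : ℕ) : ℚ) + 1 = q.den := by
      have h : q.den - 1 + 1 = q.den := Nat.succ_pred_eq_of_pos q.den_pos
      exact_mod_cast h
    simp only [posRat, Nat.unpair_pair]
    rw [h2, h3, Rat.num_div_den]

/-- A computable enumeration of all nonempty finite sequences of natural numbers. -/
def finSeq (j : ℕ) : List ℕ := j.unpair.1 :: Denumerable.ofNat (List ℕ) j.unpair.2

theorem computable_finSeq : Computable finSeq :=
  (Primrec.list_cons.comp (Primrec.fst.comp Primrec.unpair)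
    ((Primrec.ofNat (List ℕ)).comp (Primrec.snd.comp Primrec.unpair))).to_comp

theorem range_finSeq : Set.range finSeq = {l : List ℕ | l ≠ []} := by
  ext l
  simp only [Set.mem_range, Set.mem_ofPred_eq]
  constructor
  · rintro ⟨j, rfl⟩
    simp [finSeq]
  · intro hl
    obtain ⟨a, t, rfl⟩ := List.exists_cons_of_ne_nil hl
    exact ⟨Nat.pair a (Encodable.encode t), by simp [finSeq]⟩

section

variable {X : Type*} [MetricSpace X] (α : ℕ → X)

/-- The `i`-th open rational ball. -/
def openBall (i : ℕ) : Set X := Metric.ball (α i.unpair.1) (posRat i.unpair.2 : ℝ)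

/-- The `i`-th closed rational ball. -/
def closedBall (i : ℕ) : Set X := Metric.closedBall (α i.unpair.1) (posRat i.unpair.2 : ℝ)

/-- The `j`-th rational open set, a finite nonempty union of open rational balls. -/
def rationalOpen (j : ℕ) : Set X := ⋃ i ∈ finSeq j, openBall α i

/-- `S` is a computably enumerable (closed) set. -/
def IsCE (S : Set X) : Prop :=
  IsClosed S ∧ REPred fun i : ℕ => (S ∩ openBall α i).Nonempty

/-- `S` is semi-computable compact on closed balls. -/
def IsSemiCCB (S : Set X) : Prop :=
  (∀ (x : X) (r : ℝ), 0 < r → IsCompact (S ∩ Metric.closedBall x r)) ∧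
    REPred fun p : ℕ × ℕ => closedBall α p.1 ∩ S ⊆ rationalOpen α p.2

/-- `S` is computable compact on closed balls. -/
def IsCCB (S : Set X) : Prop := IsSemiCCB α S ∧ IsCE α S

end

/-- With the subspace topology, `L` is homeomorphic to the real line. -/
def IsTopologicalLine {X : Type*} [TopologicalSpace X] (L : Set X) : Prop := Nonempty (L ≃ₜ ℝ)

end CompMetric

/-!
Write `L` as the range of a closed embedding `f` of `ℝ`, and put `S = L ∪ F`. Closed balls meet `S`
in compact sets, so both ends of the line leave every bounded set.

Fix a real number `u`. The balls met by the ray `f '' Ioi u` are enumerated through certificates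
that use finite information about `f` only. A rational ball `k₀` around `f (u - 2)` is chosen that
is not met by `Q = f '' Ici (u - 1)`, and a rational ball `i₀` around `f (u - 1)` whose closed
ball meets `S` in a subset of `f '' Ioo (u - 2) u` only. A certificate for a ball `i` is a large rational
ball `b` with two finite lists `U` and `V` of rational balls such that the part of `S` in the closed
ball `b` is covered by `k₀`, `i`, `i₀`, `U` and `V`, where `i₀` and the balls of `U` are formally
disjoint from those of `V` and formally contained in `b` (`IsCertificate`). The covering condition
is c.e. because `S` is semi-c.c.b., and the formal conditions are c.e. because the metric is
computable (`rePred_exists_isCertificate`).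

* If `i` has a certificate, then `Q` meets the ball `i`
  (`IsCertificate.inter_openBall_nonempty`). Otherwise the connected set `Q`, which starts in `i₀`,
  could not leave the union of `i₀` and `U` and would be bounded.
* If `f t` lies in the ball `i` for some `t > u`, then `i` has a certificate
  (`exists_isCertificate`). Outside of the balls `k₀` and `i`, which contain `f (u - 2)` and `f t`,
  the compact set `f '' Icc (u - 2) t` is separated from the rest of `S`.

Thus a c.e. set of indices of balls meeting `L` contains all the balls that meet `f '' Ioi u`
(`exists_rePred_ray`). The same holds for `f ∘ Neg.neg`, and two such rays cover the line. The
second assertion is the case `F = ∅` of the first, since a semi-c.c.b. set is closed.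
-/

namespace CompMetric

/-! ### Computably enumerable predicates -/

section Computability

variable {β γ : Type*} [Primcodable β] [Primcodable γ]

theorem computable_list_all {p : β × γ → Bool} (hp : Computable p) :
    Computable fun x : β × List γ => x.2.all fun c => p (x.1, c) := by
  have h : Computable fun x : β × List γ =>
      Nat.rec (motive := fun _ => Bool) true
        (fun n r => r && ((x.2[n]?).map fun c => p (x.1, c)).getD true) x.2.length := by
    refine Computable.nat_rec (f := fun x : β × List γ => x.2.length)
      (h := fun x q => q.2 && ((x.2[q.1]?).map fun c => p (x.1, c)).getD true)
      (Computable.list_length.comp Computable.snd) (Computable.const true) ?_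
    refine Primrec.and.to_comp.comp (Computable.snd.comp Computable.snd) ?_
    refine Computable.option_getD (Computable.option_map ?_ ?_) (Computable.const true)
    · exact Computable.list_getElem?.comp (Computable.snd.comp Computable.fst)
        (Computable.fst.comp Computable.snd)
    · exact hp.comp ((Computable.fst.comp (Computable.fst.comp Computable.fst)).pair Computable.snd)
  refine h.of_eq fun x => ?_
  obtain ⟨b, l⟩ := x
  have key : ∀ n, Nat.rec (motive := fun _ => Bool) true
      (fun n r => r && ((l[n]?).map fun c => p (b, c)).getD true) n
        = (l.take n).all fun c => p (b, c) := by
    intro n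
    induction n with
    | zero => simp
    | succ n ih =>
      simp only [ih]
      rw [List.take_add_one, List.all_append]
      congr 1
      cases l[n]? <;> simp
  have := key l.length
  rwa [List.take_length] at this

theorem computable_list_any {p : β × γ → Bool} (hp : Computable p) :
    Computable fun x : β × List γ => x.2.any fun c => p (x.1, c) := by
  have h : Computable fun z => !p z := Primrec.not.to_comp.comp hp
  have h' : Computable fun x : β × List γ => !x.2.all fun c => !p (x.1, c) :=
    Primrec.not.to_comp.comp (computable_list_all h)
  refine h'.of_eq fun x => ?_
  rw [List.not_all_eq_any_not]
  simp

/-- The `Σ₁` normal form of a c.e. predicate. -/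
theorem rePred_iff_exists_computable {p : β → Prop} :
    REPred p ↔ ∃ d : β × ℕ → Bool, Computable d ∧ ∀ b, p b ↔ ∃ n, d (b, n) = true := by
  constructor
  · intro h
    obtain ⟨c, hc⟩ := Nat.Partrec.Code.exists_code.1 h
    refine ⟨fun x => (c.evaln x.2 (Encodable.encode x.1)).isSome, ?_, fun b => ?_⟩
    · exact Primrec.option_isSome.to_comp.comp (Nat.Partrec.Code.primrec_evaln.to_comp.comp
        ((Computable.snd.pair (Computable.const c)).pair (Computable.encode.comp Computable.fst)))
    · have h1 := congrFun hc (Encodable.encode b)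
      have h2 : p b ↔ (c.eval (Encodable.encode b)).Dom := by
        rw [h1]
        simp [Part.assert]
      rw [h2, Part.dom_iff_mem]
      simp only [Nat.Partrec.Code.evaln_complete, Option.isSome_iff_exists, Option.mem_def]
      exact exists_comm
  · rintro ⟨d, hd, h⟩
    refine (Partrec.dom_re (Partrec.rfind hd.to₂.partrec₂)).of_eq fun b => ?_
    rw [h b, Nat.rfind_dom']
    simp

theorem rePred_comp {p : γ → Prop} (hp : REPred p) {f : β → γ} (hf : Computable f) :
    REPred fun b => p (f b) :=
  Partrec.comp hp hf

theorem rePred_and {p q : β → Prop} (hp : REPred p) (hq : REPred q) :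
    REPred fun b => p b ∧ q b := by
  obtain ⟨d, hd, h⟩ := rePred_iff_exists_computable.1 hp
  obtain ⟨e, he, h'⟩ := rePred_iff_exists_computable.1 hq
  refine rePred_iff_exists_computable.2
    ⟨fun x => d (x.1, x.2.unpair.1) && e (x.1, x.2.unpair.2), ?_, fun b => ?_⟩
  · exact Primrec.and.to_comp.comp
      (hd.comp (Computable.fst.pair (Computable.fst.comp (Computable.unpair.comp Computable.snd))))
      (he.comp (Computable.fst.pair (Computable.snd.comp (Computable.unpair.comp Computable.snd))))
  · rw [h, h']
    simp only [Bool.and_eq_true]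
    constructor
    · rintro ⟨⟨m, hm⟩, n, hn⟩
      exact ⟨Nat.pair m n, by simpa using ⟨hm, hn⟩⟩
    · rintro ⟨n, h1, h2⟩
      exact ⟨⟨_, h1⟩, _, h2⟩

theorem rePred_or {p q : β → Prop} (hp : REPred p) (hq : REPred q) :
    REPred fun b => p b ∨ q b := by
  obtain ⟨d, hd, h⟩ := rePred_iff_exists_computable.1 hp
  obtain ⟨e, he, h'⟩ := rePred_iff_exists_computable.1 hq
  refine rePred_iff_exists_computable.2 ⟨fun x => d x || e x, ?_, fun b => ?_⟩
  · exact Primrec.or.to_comp.comp hd he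
  · rw [h, h']
    simp only [Bool.or_eq_true, exists_or]

theorem rePred_exists {p : β × γ → Prop} (hp : REPred p) : REPred fun b => ∃ c, p (b, c) := by
  obtain ⟨d, hd, h⟩ := rePred_iff_exists_computable.1 hp
  refine rePred_iff_exists_computable.2
    ⟨fun x => ((Encodable.decode (α := γ) x.2.unpair.1).map
      fun c => d ((x.1, c), x.2.unpair.2)).getD false, ?_, fun b => ?_⟩
  · refine Computable.option_getD (Computable.option_map ?_ ?_) (Computable.const false)
    · exact Computable.decode.comp (Computable.fst.comp (Computable.unpair.comp Computable.snd))
    · exact hd.comp (((Computable.fst.comp Computable.fst).pair Computable.snd).pair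
        (Computable.snd.comp (Computable.unpair.comp (Computable.snd.comp Computable.fst))))
  · simp only [h]
    constructor
    · rintro ⟨c, n, hn⟩
      exact ⟨Nat.pair (Encodable.encode c) n, by simpa using hn⟩
    · rintro ⟨n, hn⟩
      cases hc : Encodable.decode (α := γ) n.unpair.1 with
      | none => simp [hc] at hn
      | some c => exact ⟨c, n.unpair.2, by simpa [hc] using hn⟩

/-- A bounded universal quantifier preserves computable enumerability, since finitely many
witnesses have a common bound. -/
theorem rePred_forall_mem_list {p : β × γ → Prop} (hp : REPred p) :
    REPred fun x : β × List γ => ∀ c ∈ x.2, p (x.1, c) := by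
  obtain ⟨d, hd, h⟩ := rePred_iff_exists_computable.1 hp
  have hre : Computable fun y : (β × ℕ) × γ => ((y.1.1, y.2), List.range y.1.2) :=
    ((Computable.fst.comp Computable.fst).pair Computable.snd).pair
      (Primrec.list_range.to_comp.comp (Computable.snd.comp Computable.fst))
  have hin : Computable fun y : (β × ℕ) × γ =>
      (List.range y.1.2).any fun n => d ((y.1.1, y.2), n) := by
    have hany := computable_list_any hd
    have hcomp := hany.comp hre
    exact hcomp
  have hswap : Computable fun x : (β × List γ) × ℕ => ((x.1.1, x.2), x.1.2) :=
    ((Computable.fst.comp Computable.fst).pair Computable.snd).pair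
      (Computable.snd.comp Computable.fst)
  have hall := (computable_list_all hin).comp hswap
  refine rePred_iff_exists_computable.2
    ⟨_, hall, fun x => ?_⟩
  · obtain ⟨b, l⟩ := x
    simp only [h, List.all_eq_true, List.any_eq_true, List.mem_range]
    constructor
    · intro H
      choose! w hw using H
      refine ⟨(l.map w).sum + 1, fun c hc => ⟨w c, ?_, hw c hc⟩⟩
      exact Nat.lt_succ_of_le (List.le_sum_of_mem (List.mem_map_of_mem hc))
    · rintro ⟨N, hN⟩ c hc
      obtain ⟨n, -, hn⟩ := hN c hc
      exact ⟨n, hn⟩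

end Computability

/-! ### Comparison of distances and radii -/

section Comparison

/-- The nonnegative rational number coded by a pair of natural numbers, the second entry being the
predecessor of the denominator. -/
noncomputable def fracVal (x : ℕ × ℕ) : ℝ := (x.1 : ℝ) / ((x.2 : ℝ) + 1)

/-- Addition on codes of nonnegative rational numbers. -/
def fracAdd (x y : ℕ × ℕ) : ℕ × ℕ :=
  (x.1 * (y.2 + 1) + y.1 * (x.2 + 1), x.2 * y.2 + x.2 + y.2)

theorem fracVal_fracAdd (x y : ℕ × ℕ) : fracVal (fracAdd x y) = fracVal x + fracVal y := by
  have h1 : (x.2 : ℝ) + 1 ≠ 0 := by positivity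
  have h2 : (y.2 : ℝ) + 1 ≠ 0 := by positivity
  have h3 : (x.2 : ℝ) * y.2 + x.2 + y.2 + 1 = (x.2 + 1) * (y.2 + 1) := by ring
  simp only [fracVal, fracAdd]
  push_cast
  rw [h3, div_add_div _ _ h1 h2, mul_comm (y.1 : ℝ)]

theorem primrec_fracAdd : Primrec₂ fracAdd := by
  have a1 : Primrec fun p : (ℕ × ℕ) × ℕ × ℕ => p.1.1 := Primrec.fst.comp Primrec.fst
  have a2 : Primrec fun p : (ℕ × ℕ) × ℕ × ℕ => p.1.2 := Primrec.snd.comp Primrec.fst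
  have b1 : Primrec fun p : (ℕ × ℕ) × ℕ × ℕ => p.2.1 := Primrec.fst.comp Primrec.snd
  have b2 : Primrec fun p : (ℕ × ℕ) × ℕ × ℕ => p.2.2 := Primrec.snd.comp Primrec.snd
  have num := Primrec.nat_add.comp (Primrec.nat_mul.comp a1 (Primrec.succ.comp b2))
    (Primrec.nat_mul.comp b1 (Primrec.succ.comp a2))
  have den := Primrec.nat_add.comp (Primrec.nat_add.comp (Primrec.nat_mul.comp a2 b2) a2) b2
  exact num.pair den

theorem fracVal_lt_fracVal_iff (x y : ℕ × ℕ) :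
    fracVal x < fracVal y ↔ x.1 * (y.2 + 1) < y.1 * (x.2 + 1) := by
  rw [fracVal, fracVal, div_lt_div_iff₀ (by positivity) (by positivity)]
  exact_mod_cast Iff.rfl

theorem rePred_fracVal_lt {β : Type*} [Primcodable β] {f g : β → ℕ × ℕ} (hf : Computable f)
    (hg : Computable g) : REPred fun b => fracVal (f b) < fracVal (g b) := by
  have key : PrimrecPred fun p : (ℕ × ℕ) × ℕ × ℕ => fracVal p.1 < fracVal p.2 := by
    have a1 : Primrec fun p : (ℕ × ℕ) × ℕ × ℕ => p.1.1 := Primrec.fst.comp Primrec.fst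
    have a2 : Primrec fun p : (ℕ × ℕ) × ℕ × ℕ => p.1.2 := Primrec.snd.comp Primrec.fst
    have b1 : Primrec fun p : (ℕ × ℕ) × ℕ × ℕ => p.2.1 := Primrec.fst.comp Primrec.snd
    have b2 : Primrec fun p : (ℕ × ℕ) × ℕ × ℕ => p.2.2 := Primrec.snd.comp Primrec.snd
    have h := Primrec.nat_lt.comp (Primrec.nat_mul.comp a1 (Primrec.succ.comp b2))
      (Primrec.nat_mul.comp b1 (Primrec.succ.comp a2))
    exact h.of_eq fun p => (fracVal_lt_fracVal_iff p.1 p.2).symm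
  have hre : REPred fun p : (ℕ × ℕ) × ℕ × ℕ => fracVal p.1 < fracVal p.2 :=
    ComputablePred.to_re key.computablePred
  exact rePred_comp hre (hf.pair hg)

/-- The real radius of the `i`-th rational ball. -/
noncomputable def radius (i : ℕ) : ℝ := (posRat i.unpair.2 : ℝ)

theorem radius_pos (i : ℕ) : 0 < radius i := by
  unfold radius posRat
  positivity

/-- A code of the radius of the `i`-th rational ball. -/
def radiusCode (i : ℕ) : ℕ × ℕ := (i.unpair.2.unpair.1 + 1, i.unpair.2.unpair.2)

theorem fracVal_radiusCode (i : ℕ) : fracVal (radiusCode i) = radius i := by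
  simp [fracVal, radiusCode, radius, posRat]

theorem computable_radiusCode : Computable radiusCode := by
  have h : Primrec fun i : ℕ => i.unpair.2.unpair :=
    Primrec.unpair.comp (Primrec.snd.comp Primrec.unpair)
  exact ((Primrec.succ.comp (Primrec.fst.comp h)).pair (Primrec.snd.comp h)).to_comp

variable {X : Type*} [MetricSpace X] {α : ℕ → X}

/-- Since distances are nonnegative, they may be approximated by nonnegative rational numbers: the
absolute value of an approximation is as good as the approximation itself. -/
theorem IsComputableMetricSpace.exists_fracVal_approx (hα : IsComputableMetricSpace α) :
    ∃ g : (ℕ × ℕ) × ℕ → ℕ × ℕ, Computable g ∧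
      ∀ p k, |dist (α p.1) (α p.2) - fracVal (g (p, k))| < 1 / ((k : ℝ) + 1) := by
  obtain ⟨F, ⟨a, b, c, ha, hb, -, hF⟩, h⟩ := hα.computable_dist
  refine ⟨fun x => (a x, b x), ha.pair hb, fun p k => ?_⟩
  have habs : fracVal (a (p, k), b (p, k)) = |(F (p, k) : ℝ)| := by
    rw [hF]
    push_cast
    rw [abs_mul, abs_pow, abs_neg, abs_one, one_pow, one_mul, abs_of_nonneg (by positivity)]
    rfl
  have hpow : (1 / 2 : ℝ) ^ k ≤ 1 / ((k : ℝ) + 1) := by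
    rw [one_div_pow]
    have hk : (k : ℝ) + 1 ≤ 2 ^ k := by exact_mod_cast Nat.succ_le_of_lt k.lt_two_pow_self
    exact one_div_le_one_div_of_le (by positivity) hk
  have hd : dist (α p.1) (α p.2) = |dist (α p.1) (α p.2)| := (abs_of_nonneg dist_nonneg).symm
  rw [habs, hd]
  exact (abs_abs_sub_abs_le _ _).trans_lt ((h p k).trans_le hpow)

/-- The numbers `1 / (k + 1)` bounding approximation errors are eventually below any `ε > 0`. -/
theorem exists_fracVal_one_lt {ε : ℝ} (hε : 0 < ε) : ∃ k : ℕ, fracVal (1, k) < ε := by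
  obtain ⟨k, hk⟩ := exists_nat_one_div_lt hε
  exact ⟨k, by simpa [fracVal] using hk⟩

theorem fracVal_one (k : ℕ) : fracVal (1, k) = 1 / ((k : ℝ) + 1) := by simp [fracVal]

theorem IsComputableMetricSpace.rePred_fracVal_lt_dist (hα : IsComputableMetricSpace α)
    {β : Type*} [Primcodable β] {f : β → ℕ × ℕ} {u : β → ℕ × ℕ} (hf : Computable f)
    (hu : Computable u) : REPred fun b => fracVal (f b) < dist (α (u b).1) (α (u b).2) := by
  obtain ⟨g, hg, h⟩ := hα.exists_fracVal_approx
  have hgu : Computable fun x : β × ℕ => g (u x.1, x.2) :=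
    hg.comp ((hu.comp Computable.fst).pair Computable.snd)
  have hadd : Computable fun x : β × ℕ => fracAdd (f x.1) (1, x.2) :=
    primrec_fracAdd.to_comp.comp (hf.comp Computable.fst)
      ((Computable.const 1).pair Computable.snd)
  refine (rePred_exists (rePred_fracVal_lt hadd hgu)).of_eq fun b => ?_
  simp only [fracVal_fracAdd]
  constructor
  · rintro ⟨k, hk⟩
    have := (abs_lt.1 (h (u b) k)).1
    rw [← fracVal_one] at this
    linarith
  · intro hb
    obtain ⟨k, hk⟩ := exists_fracVal_one_lt (half_pos (sub_pos.2 hb))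
    refine ⟨k, ?_⟩
    have := (abs_lt.1 (h (u b) k)).2
    rw [← fracVal_one] at this
    linarith

theorem IsComputableMetricSpace.rePred_dist_add_fracVal_lt (hα : IsComputableMetricSpace α)
    {β : Type*} [Primcodable β] {f f' : β → ℕ × ℕ} {u : β → ℕ × ℕ} (hf : Computable f)
    (hf' : Computable f') (hu : Computable u) :
    REPred fun b => dist (α (u b).1) (α (u b).2) + fracVal (f b) < fracVal (f' b) := by
  obtain ⟨g, hg, h⟩ := hα.exists_fracVal_approx
  have hgu : Computable fun x : β × ℕ => g (u x.1, x.2) :=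
    hg.comp ((hu.comp Computable.fst).pair Computable.snd)
  have hadd : Computable fun x : β × ℕ => fracAdd (f x.1) (1, x.2) :=
    primrec_fracAdd.to_comp.comp (hf.comp Computable.fst)
      ((Computable.const 1).pair Computable.snd)
  have hsum : Computable fun x : β × ℕ => fracAdd (g (u x.1, x.2)) (fracAdd (f x.1) (1, x.2)) :=
    primrec_fracAdd.to_comp.comp hgu hadd
  refine (rePred_exists (rePred_fracVal_lt hsum (hf'.comp Computable.fst))).of_eq fun b => ?_
  simp only [fracVal_fracAdd]
  constructor
  · rintro ⟨k, hk⟩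
    have := (abs_lt.1 (h (u b) k)).2
    rw [← fracVal_one] at this
    linarith
  · intro hb
    obtain ⟨k, hk⟩ := exists_fracVal_one_lt (half_pos (sub_pos.2 hb))
    refine ⟨k, ?_⟩
    have := (abs_lt.1 (h (u b) k)).1
    rw [← fracVal_one] at this
    linarith

theorem computable_unpair_fst_pair :
    Computable fun p : ℕ × ℕ => (p.1.unpair.1, p.2.unpair.1) :=
  ((Primrec.fst.comp (Primrec.unpair.comp Primrec.fst)).pair
    (Primrec.fst.comp (Primrec.unpair.comp Primrec.snd))).to_comp

/-- Formal disjointness of rational balls is c.e. -/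
theorem IsComputableMetricSpace.rePred_radius_add_radius_lt_dist
    (hα : IsComputableMetricSpace α) :
    REPred fun p : ℕ × ℕ =>
      radius p.1 + radius p.2 < dist (α p.1.unpair.1) (α p.2.unpair.1) := by
  have hadd : Computable fun p : ℕ × ℕ => fracAdd (radiusCode p.1) (radiusCode p.2) :=
    primrec_fracAdd.to_comp.comp (computable_radiusCode.comp Computable.fst)
      (computable_radiusCode.comp Computable.snd)
  refine (hα.rePred_fracVal_lt_dist hadd computable_unpair_fst_pair).of_eq fun p => ?_
  rw [fracVal_fracAdd, fracVal_radiusCode, fracVal_radiusCode]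

/-- Formal inclusion of rational balls is c.e. -/
theorem IsComputableMetricSpace.rePred_dist_add_radius_lt_radius
    (hα : IsComputableMetricSpace α) :
    REPred fun p : ℕ × ℕ =>
      dist (α p.1.unpair.1) (α p.2.unpair.1) + radius p.1 < radius p.2 := by
  refine (hα.rePred_dist_add_fracVal_lt (computable_radiusCode.comp Computable.fst)
    (computable_radiusCode.comp Computable.snd) computable_unpair_fst_pair).of_eq fun p => ?_
  rw [fracVal_radiusCode, fracVal_radiusCode]

end Comparison

/-! ### Covers by small rational balls -/

section Covers

variable {X : Type*} [MetricSpace X] {α : ℕ → X}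

theorem mem_openBall_iff {i : ℕ} {x : X} :
    x ∈ openBall α i ↔ dist x (α i.unpair.1) < radius i := Iff.rfl

theorem mem_closedBall_iff {i : ℕ} {x : X} :
    x ∈ closedBall α i ↔ dist x (α i.unpair.1) ≤ radius i := Iff.rfl

theorem isOpen_openBall (i : ℕ) : IsOpen (openBall α i) := Metric.isOpen_ball

theorem isClosed_closedBall (i : ℕ) : IsClosed (closedBall α i) := Metric.isClosed_closedBall

theorem exists_mem_openBall_radius_lt (hα : DenseRange α) (x : X) {δ : ℝ} (hδ : 0 < δ) :
    ∃ m, x ∈ openBall α m ∧ radius m < δ := by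
  obtain ⟨n, hn⟩ := exists_nat_one_div_lt hδ
  have hpos : (0 : ℝ) < 1 / ((n : ℝ) + 1) := by positivity
  obtain ⟨j, hj⟩ := hα.exists_dist_lt x hpos
  have hr : radius (Nat.pair j (Nat.pair 0 n)) = 1 / ((n : ℝ) + 1) := by simp [radius, posRat]
  refine ⟨Nat.pair j (Nat.pair 0 n), ?_, by rwa [hr]⟩
  rw [mem_openBall_iff, hr]
  simpa using hj

theorem exists_mem_openBall_closedBall_subset (hα : DenseRange α) {O : Set X} (hO : IsOpen O)
    {x : X} (hx : x ∈ O) : ∃ m, x ∈ openBall α m ∧ closedBall α m ⊆ O := by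
  obtain ⟨δ, hδ, hball⟩ := Metric.isOpen_iff.1 hO x hx
  obtain ⟨m, hm, hr⟩ := exists_mem_openBall_radius_lt hα x (half_pos hδ)
  refine ⟨m, hm, fun y hy => hball ?_⟩
  rw [mem_openBall_iff] at hm
  rw [mem_closedBall_iff] at hy
  have := dist_triangle_right y x (α m.unpair.1)
  rw [Metric.mem_ball]
  linarith

theorem exists_list_cover {K : Set X} (hK : IsCompact K) {P : ℕ → Prop}
    (h : ∀ x ∈ K, ∃ m, x ∈ openBall α m ∧ P m) :
    ∃ l : List ℕ, (∀ m ∈ l, P m) ∧ K ⊆ ⋃ m ∈ l, openBall α m := by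
  choose! w hw using h
  obtain ⟨t, ht, hcov⟩ := hK.elim_nhds_subcover (fun x => openBall α (w x))
    fun x hx => (isOpen_openBall _).mem_nhds (hw x hx).1
  refine ⟨t.toList.map w, fun m hm => ?_, hcov.trans ?_⟩
  · obtain ⟨x, hx, rfl⟩ := List.mem_map.1 hm
    exact (hw x (ht x (Finset.mem_toList.1 hx))).2
  · refine Set.iUnion₂_subset fun x hx => ?_
    exact Set.subset_biUnion_of_mem (u := fun m => openBall α m)
      (List.mem_map_of_mem (Finset.mem_toList.2 hx) : w x ∈ t.toList.map w)

end Covers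

/-! ### Certificates -/

section Certificate

variable {X : Type*} [MetricSpace X] (α : ℕ → X)

/-- A certificate `(b, U, V)` that every connected unbounded subset of `S` which misses the ball
`k₀` and starts in the ball `i₀` meets the ball `i`. Apart from the balls `k₀` and `i`, the part of
`S` in the closed ball `b` is covered by the balls `i₀ :: U` and the balls `V`; the former are
formally disjoint from the latter and formally contained in the ball `b`. -/
def IsCertificate (S : Set X) (k₀ i₀ i : ℕ) (c : ℕ × List ℕ × List ℕ) : Prop :=
  (closedBall α c.1 ∩ S ⊆ ⋃ m ∈ k₀ :: i :: i₀ :: (c.2.1 ++ c.2.2), openBall α m) ∧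
    (∀ m ∈ i₀ :: c.2.1, ∀ v ∈ c.2.2,
      radius m + radius v < dist (α m.unpair.1) (α v.unpair.1)) ∧
    ∀ m ∈ i₀ :: c.2.1, dist (α m.unpair.1) (α c.1.unpair.1) + radius m < radius c.1

variable {α}

theorem rePred_exists_isCertificate (hα : IsComputableMetricSpace α) {S : Set X}
    (hS : IsSemiCCB α S) (k₀ i₀ : ℕ) :
    REPred fun i => ∃ c, IsCertificate α S k₀ i₀ i c := by
  have hb : Computable fun x : ℕ × ℕ × List ℕ × List ℕ => x.2.1 :=
    Computable.fst.comp Computable.snd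
  have hU : Computable fun x : ℕ × ℕ × List ℕ × List ℕ => i₀ :: x.2.2.1 :=
    Computable.list_cons.comp (Computable.const i₀)
      (Computable.fst.comp (Computable.snd.comp Computable.snd))
  have hV : Computable fun x : ℕ × ℕ × List ℕ × List ℕ => x.2.2.2 :=
    Computable.snd.comp (Computable.snd.comp Computable.snd)
  have htail : Computable fun x : ℕ × ℕ × List ℕ × List ℕ =>
      x.1 :: i₀ :: (x.2.2.1 ++ x.2.2.2) :=
    Computable.list_cons.comp Computable.fst (Computable.list_append.comp hU hV)
  have hcode : Computable fun x : ℕ × ℕ × List ℕ × List ℕ =>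
      Nat.pair k₀ (Encodable.encode (x.1 :: i₀ :: (x.2.2.1 ++ x.2.2.2))) :=
    Primrec₂.natPair.to_comp.comp (Computable.const k₀) (Computable.encode.comp htail)
  have hcov := rePred_comp hS.2 (hb.pair hcode)
  have hswap : Computable fun p : ℕ × ℕ => (p.2, p.1) := Computable.snd.pair Computable.fst
  have hswap' : Computable fun p : List ℕ × ℕ => (p.2, p.1) :=
    Computable.snd.pair Computable.fst
  have hin := rePred_comp
    (rePred_forall_mem_list (rePred_comp hα.rePred_dist_add_radius_lt_radius hswap))
    (hb.pair hU)
  have hdisj := rePred_comp (rePred_forall_mem_list (rePred_comp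
    (rePred_forall_mem_list hα.rePred_radius_add_radius_lt_dist) hswap')) (hV.pair hU)
  refine (rePred_exists (rePred_and hcov (rePred_and hdisj hin))).of_eq fun i => ?_
  refine exists_congr fun c => and_congr ?_ (and_congr Iff.rfl Iff.rfl)
  simp only [rationalOpen, finSeq, Nat.unpair_pair, Denumerable.ofNat_encode]

/-- A connected unbounded set that starts in `i₀` and avoids `k₀` and `i` would be trapped in the
balls `i₀ :: U`, because it can leave them neither within the closed ball `b`, where it would have
to jump to the balls `V`, nor by leaving the ball `b`, which contains them. -/
theorem IsCertificate.inter_openBall_nonempty {S Q : Set X} {k₀ i₀ i : ℕ}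
    {c : ℕ × List ℕ × List ℕ} (h : IsCertificate α S k₀ i₀ i c) (hQS : Q ⊆ S)
    (hQ : IsPreconnected Q) (hunb : ¬ Bornology.IsBounded Q) (hk₀ : Disjoint Q (openBall α k₀))
    (hi₀ : (Q ∩ openBall α i₀).Nonempty) : (Q ∩ openBall α i).Nonempty := by
  obtain ⟨b, lU, lV⟩ := c
  obtain ⟨hcov, hdisj, hin⟩ := h
  simp only at hcov hdisj hin
  by_contra hne
  set U : Set X := ⋃ m ∈ i₀ :: lU, openBall α m with hUdef
  set V : Set X := ⋃ m ∈ lV, openBall α m with hVdef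
  have hU : IsOpen U := isOpen_biUnion fun m _ => isOpen_openBall m
  have hV : IsOpen V := isOpen_biUnion fun m _ => isOpen_openBall m
  have hUb : U ⊆ closedBall α b := by
    refine Set.iUnion₂_subset fun m hm x hx => ?_
    have h1 := hin m hm
    rw [mem_openBall_iff] at hx
    rw [mem_closedBall_iff]
    linarith [dist_triangle x (α m.unpair.1) (α b.unpair.1)]
  have hUV : Disjoint U (V ∪ (closedBall α b)ᶜ) := by
    refine Disjoint.sup_right ?_ (Set.disjoint_compl_right_iff_subset.2 hUb)
    refine Set.disjoint_left.2 fun x hxU hxV => ?_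
    obtain ⟨m, hm, hxm⟩ := Set.mem_iUnion₂.1 hxU
    obtain ⟨v, hv, hxv⟩ := Set.mem_iUnion₂.1 hxV
    have h1 := hdisj m hm v hv
    rw [mem_openBall_iff] at hxm hxv
    linarith [dist_triangle_left (α m.unpair.1) (α v.unpair.1) x]
  have hQcov : Q ⊆ U ∪ (V ∪ (closedBall α b)ᶜ) := by
    intro x hx
    by_cases hxb : x ∈ closedBall α b
    · obtain ⟨m, hm, hxm⟩ := Set.mem_iUnion₂.1 (hcov ⟨hxb, hQS hx⟩)
      simp only [List.mem_cons, List.mem_append] at hm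
      rcases hm with rfl | rfl | rfl | hm | hm
      · exact absurd hxm (Set.disjoint_left.1 hk₀ hx)
      · exact absurd ⟨x, hx, hxm⟩ hne
      · exact Or.inl (Set.mem_iUnion₂.2 ⟨m, List.mem_cons_self, hxm⟩)
      · exact Or.inl (Set.mem_iUnion₂.2 ⟨m, List.mem_cons_of_mem _ hm, hxm⟩)
      · exact Or.inr (Or.inl (Set.mem_iUnion₂.2 ⟨m, hm, hxm⟩))
    · exact Or.inr (Or.inr hxb)
  have hQU : (Q ∩ U).Nonempty := by
    obtain ⟨x, hxQ, hx⟩ := hi₀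
    exact ⟨x, hxQ, Set.mem_iUnion₂.2 ⟨i₀, List.mem_cons_self, hx⟩⟩
  have hsub : Q ⊆ U := hQ.subset_left_of_subset_union hU
    (hV.union (isClosed_closedBall b).isOpen_compl) hUV hQcov hQU
  exact hunb (Metric.isBounded_closedBall.subset (hsub.trans hUb))

/-- If `S` is the union of a compact set `A` and a closed set `C` which only meet inside the balls
`k₀` and `i`, then the separation of `A` and `C` outside of these balls yields a certificate. -/
theorem exists_isCertificate (hα : DenseRange α) {S A C : Set X}
    (hS : ∀ (x : X) (r : ℝ), 0 < r → IsCompact (S ∩ Metric.closedBall x r)) {k₀ i₀ i : ℕ}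
    (hA : IsCompact A) (hC : IsClosed C) (hCS : C ⊆ S) (hSAC : S ⊆ A ∪ C)
    (hAC : A ∩ C ⊆ openBall α k₀ ∪ openBall α i) (hi₀ : Disjoint (closedBall α i₀) C) :
    ∃ c, IsCertificate α S k₀ i₀ i c := by
  set W : Set X := openBall α k₀ ∪ openBall α i with hWdef
  have hW : IsOpen W := (isOpen_openBall _).union (isOpen_openBall _)
  have hA' : IsCompact (A \ W) := hA.diff hW
  obtain ⟨M, hM⟩ := hA'.isBounded.subset_closedBall (α 0)
  obtain ⟨N, hN⟩ := exists_nat_gt (max (M + 2) (dist (α i₀.unpair.1) (α 0) + radius i₀))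
  obtain ⟨hN1, hN2⟩ := max_lt_iff.1 hN
  -- The ball of radius `N + 1` about `α 0` formally contains `i₀` and all balls of radius below `1`
  -- that meet `A \ W`.
  set b : ℕ := Nat.pair 0 (Nat.pair N 0) with hbdef
  have hbr : radius b = N + 1 := by simp [hbdef, radius, posRat]
  have hbc : α b.unpair.1 = α 0 := by simp [hbdef]
  have hB : IsCompact ((closedBall α b ∩ C) \ W) := by
    have h1 : IsCompact (S ∩ closedBall α b) := hS _ _ (radius_pos b)
    refine IsCompact.diff (h1.of_isClosed_subset ((isClosed_closedBall b).inter hC) ?_) hW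
    exact fun x hx => ⟨hCS hx.2, hx.1⟩
  have hAB : Disjoint (A \ W) ((closedBall α b ∩ C) \ W) :=
    Set.disjoint_left.2 fun x hxA hxB => hxA.2 (hAC ⟨hxA.1, hxB.1.2⟩)
  -- Balls of radius below `r / 4` meeting the one or the other set are formally disjoint when the
  -- two sets are more than `r` apart.
  obtain ⟨r, hr, hrAB⟩ := Metric.exists_pos_forall_lt_edist hA' hB.isClosed hAB
  have hr' : (0 : ℝ) < r := hr
  have hdist : ∀ x ∈ A \ W, ∀ y ∈ (closedBall α b ∩ C) \ W, (r : ℝ) < dist x y := by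
    intro x hx y hy
    have h1 := hrAB x hx y hy
    rw [edist_nndist] at h1
    exact_mod_cast h1
  obtain ⟨lU, hlU, hUcov⟩ := exists_list_cover (α := α) hA'
    (P := fun m => radius m < min ((r : ℝ) / 4) 1 ∧ ∃ x ∈ A \ W, x ∈ openBall α m) fun x hx => by
      obtain ⟨m, hm, hmr⟩ := exists_mem_openBall_radius_lt hα x
        (δ := min ((r : ℝ) / 4) 1) (by positivity)
      exact ⟨m, hm, hmr, x, hx, hm⟩
  obtain ⟨lV, hlV, hVcov⟩ := exists_list_cover (α := α) hB
    (P := fun v => (radius v < r / 4 ∧ ∃ y ∈ (closedBall α b ∩ C) \ W, y ∈ openBall α v) ∧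
      radius i₀ + radius v < dist (α i₀.unpair.1) (α v.unpair.1)) fun y hy => by
      have hgap : 0 < dist y (α i₀.unpair.1) - radius i₀ := by
        have h1 := Set.disjoint_right.1 hi₀ hy.1.2
        rw [mem_closedBall_iff, not_le] at h1
        linarith
      obtain ⟨v, hv, hvr⟩ := exists_mem_openBall_radius_lt hα y
        (δ := min ((r : ℝ) / 4) ((dist y (α i₀.unpair.1) - radius i₀) / 2)) (by positivity)
      obtain ⟨hvr1, hvr2⟩ := lt_min_iff.1 hvr
      refine ⟨v, hv, ⟨hvr1, y, hy, hv⟩, ?_⟩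
      rw [mem_openBall_iff] at hv
      have h1 := dist_triangle_left y (α i₀.unpair.1) (α v.unpair.1)
      have h2 := dist_comm (α v.unpair.1) y
      have h3 := dist_comm (α v.unpair.1) (α i₀.unpair.1)
      linarith
  refine ⟨(b, lU, lV), ?_, ?_, ?_⟩
  · rintro x ⟨hxb, hxS⟩
    rw [Set.mem_iUnion₂]
    by_cases hxW : x ∈ W
    · rcases hxW with hx | hx
      · exact ⟨k₀, by simp, hx⟩
      · exact ⟨i, by simp, hx⟩
    · rcases hSAC hxS with hx | hx
      · obtain ⟨m, hm, hxm⟩ := Set.mem_iUnion₂.1 (hUcov ⟨hx, hxW⟩)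
        exact ⟨m, by simp [hm], hxm⟩
      · obtain ⟨m, hm, hxm⟩ := Set.mem_iUnion₂.1 (hVcov ⟨⟨hxb, hx⟩, hxW⟩)
        exact ⟨m, by simp [hm], hxm⟩
  · intro m hm v hv
    obtain ⟨⟨hvr, y, hy, hyv⟩, hvi⟩ := hlV v hv
    rcases List.mem_cons.1 hm with rfl | hm
    · exact hvi
    · obtain ⟨hmr, x, hx, hxm⟩ := hlU m hm
      have h1 := hdist x hx y hy
      have h2 := (lt_min_iff.1 hmr).1
      rw [mem_openBall_iff] at hxm hyv
      have h3 := dist_triangle4 x (α m.unpair.1) (α v.unpair.1) y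
      rw [dist_comm (α v.unpair.1) y] at h3
      linarith
  · intro m hm
    simp only [hbr, hbc]
    rcases List.mem_cons.1 hm with rfl | hm
    · linarith
    · obtain ⟨hmr, x, hx, hxm⟩ := hlU m hm
      have h1 := (lt_min_iff.1 hmr).2
      have h2 := Metric.mem_closedBall.1 (hM hx)
      rw [mem_openBall_iff] at hxm
      linarith [dist_triangle_left (α m.unpair.1) (α 0) x]

end Certificate

/-! ### Topological lines -/

section Line

variable {X : Type*} [MetricSpace X] {α : ℕ → X}

theorem not_isBounded_image_Ici {S : Set X}
    (hS : ∀ (x : X) (r : ℝ), 0 < r → IsCompact (S ∩ Metric.closedBall x r)) {f : ℝ → X}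
    (hf : Topology.IsClosedEmbedding f) (hfS : Set.range f ⊆ S) (a : ℝ) :
    ¬ Bornology.IsBounded (f '' Set.Ici a) := by
  intro hb
  obtain ⟨r, hr, hsub⟩ := hb.subset_closedBall_lt 0 (f a)
  have hcomp : IsCompact (f ⁻¹' (S ∩ Metric.closedBall (f a) r)) :=
    hf.isCompact_preimage (hS _ _ hr)
  refine not_bddAbove_Ici a (hcomp.bddAbove.mono fun t ht => ?_)
  exact ⟨hfS ⟨t, rfl⟩, hsub ⟨t, ht, rfl⟩⟩

/-- The balls met by the ray `f '' Ioi u` can be enumerated without listing any ball that misses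
the line `range f`. -/
theorem exists_rePred_ray (hα : IsComputableMetricSpace α) {f : ℝ → X}
    (hf : Topology.IsClosedEmbedding f) {F : Set X} (hF : IsClosed F)
    (hdisj : Disjoint (Set.range f) F) (hS : IsSemiCCB α (Set.range f ∪ F)) (u : ℝ) :
    ∃ E : ℕ → Prop, REPred E ∧ (∀ i, E i → (Set.range f ∩ openBall α i).Nonempty) ∧
      ∀ i t, u < t → f t ∈ openBall α i → E i := by
  have hfi : ∀ {s : ℝ} {T : Set ℝ}, f s ∈ f '' T ↔ s ∈ T := hf.injective.mem_set_image
  have hfF : ∀ s, f s ∉ F := fun s => Set.disjoint_left.1 hdisj ⟨s, rfl⟩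
  -- The ball `k₀` cuts the line at `f (u - 2)`; the ray from `f (u - 1)` on does not meet it.
  obtain ⟨k₀, hk₀, hk₀sub⟩ := exists_mem_openBall_closedBall_subset hα.dense
    (hf.isClosedMap _ (isClosed_Ici (a := u - 1))).isOpen_compl
    (x := f (u - 2)) (by rw [Set.mem_compl_iff, hfi, Set.mem_Ici]; linarith)
  have hclosed : ∀ t, IsClosed (F ∪ (f '' Set.Iic (u - 2) ∪ f '' Set.Ici t)) := fun t =>
    hF.union ((hf.isClosedMap _ isClosed_Iic).union (hf.isClosedMap _ isClosed_Ici))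
  obtain ⟨i₀, hi₀, hi₀sub⟩ := exists_mem_openBall_closedBall_subset hα.dense
    (hclosed u).isOpen_compl (x := f (u - 1)) (by
      rintro (h | h | h)
      · exact hfF _ h
      · rw [hfi, Set.mem_Iic] at h
        linarith
      · rw [hfi, Set.mem_Ici] at h
        linarith)
  refine ⟨_, rePred_exists_isCertificate hα hS k₀ i₀, ?_, ?_⟩
  · rintro i ⟨c, hc⟩
    have hsub : f '' Set.Ici (u - 1) ⊆ Set.range f := Set.image_subset_range _ _
    refine (hc.inter_openBall_nonempty (Q := f '' Set.Ici (u - 1))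
      (hsub.trans Set.subset_union_left) (isPreconnected_Ici.image _ hf.continuous.continuousOn)
      (not_isBounded_image_Ici hS.1 hf Set.subset_union_left _) ?_
      ⟨f (u - 1), ⟨_, Set.self_mem_Ici, rfl⟩, hi₀⟩).mono (Set.inter_subset_inter_left _ hsub)
    exact Set.disjoint_right.2 fun x hx => hk₀sub (Metric.ball_subset_closedBall hx)
  · intro i t hut hti
    refine exists_isCertificate hα.dense hS.1
      ((isCompact_Icc (a := u - 2) (b := t)).image hf.continuous) (hclosed t) ?_ ?_ ?_ ?_
    · rintro x (h | ⟨s, -, rfl⟩ | ⟨s, -, rfl⟩)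
      · exact Or.inr h
      · exact Or.inl ⟨s, rfl⟩
      · exact Or.inl ⟨s, rfl⟩
    · rintro x (⟨s, rfl⟩ | h)
      · rcases le_total s (u - 2) with h1 | h1
        · exact Or.inr (Or.inr (Or.inl ⟨s, h1, rfl⟩))
        · rcases le_total s t with h2 | h2
          · exact Or.inl ⟨s, ⟨h1, h2⟩, rfl⟩
          · exact Or.inr (Or.inr (Or.inr ⟨s, h2, rfl⟩))
      · exact Or.inr (Or.inl h)
    · rintro x ⟨⟨s, hs, rfl⟩, h | h | h⟩
      · exact absurd h (hfF s)
      · rw [hfi] at h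
        exact Or.inl (le_antisymm h hs.1 ▸ hk₀)
      · rw [hfi] at h
        exact Or.inr (le_antisymm h hs.2 ▸ hti)
    · refine Set.disjoint_left.2 fun x hx hxC => hi₀sub hx ?_
      exact Set.union_subset_union_right _
        (Set.union_subset_union_right _ (Set.image_mono (Set.Ici_subset_Ici.2 hut.le))) hxC

theorem isCE_of_isSemiCCB_union (hα : IsComputableMetricSpace α) {L F : Set X}
    (hline : IsTopologicalLine L) (hL : IsClosed L) (hF : IsClosed F) (hdisj : Disjoint L F)
    (hS : IsSemiCCB α (L ∪ F)) : IsCE α L := by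
  obtain ⟨e⟩ := hline
  obtain ⟨f, hf, rfl⟩ : ∃ f : ℝ → X, Topology.IsClosedEmbedding f ∧ Set.range f = L :=
    ⟨fun t => (e.symm t : X), hL.isClosedEmbedding_subtypeVal.comp e.symm.isClosedEmbedding, by
      rw [← Function.comp_def, Set.range_comp, e.symm.surjective.range_eq, Set.image_univ,
        Subtype.range_coe]⟩
  have hg : Topology.IsClosedEmbedding (f ∘ Neg.neg) :=
    hf.comp (Homeomorph.neg ℝ).isClosedEmbedding
  have hrange : Set.range (f ∘ Neg.neg) = Set.range f := neg_surjective.range_comp f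
  -- The rays `Ioi (-1)` and `Iio 1` cover the line.
  obtain ⟨E, hE, hE1, hE2⟩ := exists_rePred_ray hα hf hF hdisj hS (-1)
  obtain ⟨E', hE', hE1', hE2'⟩ := exists_rePred_ray hα hg hF (hrange ▸ hdisj) (hrange ▸ hS) (-1)
  refine ⟨hL, (rePred_or hE hE').of_eq fun i => ⟨?_, ?_⟩⟩
  · rintro (h | h)
    · exact hE1 i h
    · exact hrange ▸ hE1' i h
  · rintro ⟨x, ⟨t, rfl⟩, ht⟩
    rcases lt_or_ge (-1) t with h | h
    · exact Or.inl (hE2 i t h ht)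
    · exact Or.inr (hE2' i (-t) (by linarith) (by simpa using ht))

theorem isClosed_of_isCompact_inter_closedBall {S : Set X}
    (hS : ∀ (x : X) (r : ℝ), 0 < r → IsCompact (S ∩ Metric.closedBall x r)) : IsClosed S := by
  refine isClosed_of_closure_subset fun x hx => ?_
  have h1 : x ∈ closure (S ∩ Metric.closedBall x 1) := by
    refine closure_mono (Set.inter_subset_inter_right S Metric.ball_subset_closedBall) ?_
    exact Metric.isOpen_ball.closure_inter ⟨hx, Metric.mem_ball_self one_pos⟩
  exact ((hS x 1 one_pos).isClosed.closure_subset h1).1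

end Line

end CompMetric

theorem mainTheorem4 {X : Type*} [MetricSpace X] (α : ℕ → X)
    (hα : CompMetric.IsComputableMetricSpace α) :
    (∀ L F : Set X, CompMetric.IsTopologicalLine L → IsClosed L → IsClosed F → Disjoint L F →
      CompMetric.IsSemiCCB α (L ∪ F) → CompMetric.IsCE α L) ∧
    (∀ L : Set X, CompMetric.IsTopologicalLine L → CompMetric.IsSemiCCB α L →
      CompMetric.IsCCB α L) := by
  refine ⟨fun L F hline hL hF hdisj hS =>
    CompMetric.isCE_of_isSemiCCB_union hα hline hL hF hdisj hS, fun L hline hS => ⟨hS, ?_⟩⟩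
  exact CompMetric.isCE_of_isSemiCCB_union hα hline
    (CompMetric.isClosed_of_isCompact_inter_closedBall hS.1) isClosed_empty
    (Set.disjoint_empty L) (by rwa [Set.union_empty])
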